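/- Let $(W,R)$ be a Coxeter system, where $W$ is not assumed finite and the set $R$ of fundamental reflections may be infinite, and let $\ell$ be the length function of $W$ with respect to $R$. Let $\mathcal{W} = \{ w \in W \mid w = xy \text{ for some } x, y \in W \text{ with } x^2 = 1 = y^2 \}$ be the set of strongly real elements of $W$, and for $w \in \mathcal{W}$ define the excess of $w$ by $$e(w) = \min\{\ell(x) + \ell(y) - \ell(w) \mid x, y \in W,\ w = xy,\ x^2 = y^2 = 1\}.$$ Let $w \in \mathcal{W}$, and let $X$ be the $W$-conjugacy class of $w$. Then there exists $w_* \in X$ with $e(w_*) = 0$. That is, there are $\sigma, \tau \in W$ with $\sigma^2 = 1 = \tau^2$, $w_* = \sigma\tau$ and $\ell(w_*) = \ell(\sigma) + \ell(\tau)$. -/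

import Mathlib

/-- The set of strongly real elements of a group: the products `x * y` with `x ^ 2 = 1 = y ^ 2`
(each factor is an involution or the identity). -/
def stronglyRealElements (W : Type*) [Group W] : Set W :=
  {w | ∃ x y : W, w = x * y ∧ x ^ 2 = 1 ∧ y ^ 2 = 1}

namespace CoxeterSystem

/-- The set of values `ℓ(x) + ℓ(y) - ℓ(w)`, over all `x`, `y` with `w = x * y` and
`x ^ 2 = y ^ 2 = 1`. -/
def excessSet {B W : Type*} [Group W] {M : CoxeterMatrix B} (cs : CoxeterSystem M W) (w : W) :
    Set ℤ :=
  {n | ∃ x y : W, w = x * y ∧ x ^ 2 = 1 ∧ y ^ 2 = 1 ∧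
    n = (cs.length x : ℤ) + cs.length y - cs.length w}

/-- The excess of `w`: the minimum of `excessSet`. It is meaningful for strongly real `w`, where
the set is nonempty; see `isLeast_excess`. -/
noncomputable def excess {B W : Type*} [Group W] {M : CoxeterMatrix B} (cs : CoxeterSystem M W)
    (w : W) : ℤ :=
  sInf (cs.excessSet w)

/-- For strongly real `w` the infimum in the definition of the excess is a minimum. -/
theorem isLeast_excess {B W : Type*} [Group W] {M : CoxeterMatrix B} (cs : CoxeterSystem M W)
    {w : W} (hw : w ∈ stronglyRealElements W) : IsLeast (cs.excessSet w) (cs.excess w) := by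
  have hbdd : BddBelow (cs.excessSet w) := by
    refine ⟨0, ?_⟩
    rintro n ⟨x, y, rfl, -, -, rfl⟩
    have := cs.length_mul_le x y
    omega
  obtain ⟨x, y, h, hx, hy⟩ := hw
  have hne : (cs.excessSet w).Nonempty := ⟨_, x, y, h, hx, hy, rfl⟩
  exact ⟨Int.csInf_mem hne hbdd, fun n hn => csInf_le hbdd hn⟩

end CoxeterSystem

namespace CoxeterSystem

variable {B W : Type*} [Group W] {M : CoxeterMatrix B} (cs : CoxeterSystem M W)

/-! ### The exchange condition -/

/-! Among pairs of involutions (or 1) whose product `x * y` is conjugate to `w`, take one with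
`(ℓ(y), ℓ(x))` lexicographically minimal, and let `J` be the right descents of `y`. Each `s` in `J`
commutes with `y`, as conjugating the pair by `s` would otherwise shorten `y`; this forces `y` into
the parabolic subgroup `W_J`. No `s` in `J` is a right descent of `x`: otherwise `(x * s, s * y)` or
the conjugate by `s` is a smaller pair. So `x` is shortest in `x W_J`, and lengths add. Both the
dichotomy for involutions and the coset facts rest on the exchange condition. -/

theorem functionEnd_mul_apply {α : Type*} (f g : Function.End α) (a : α) :
    (f * g) a = f (g a) := rfl

open Classical in
/-- The action of a simple reflection on `W × ZMod 2`: conjugation on the first factor, changing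
the sign exactly at the simple reflection itself. -/
noncomputable def signedConj (i : B) : Function.End (W × ZMod 2) :=
  fun p => (cs.simple i * p.1 * cs.simple i, p.2 + if p.1 = cs.simple i then 1 else 0)

open Classical in
theorem signedConj_mul_pow_apply (i j : B) (n : ℕ) (t : W) (ε : ZMod 2) :
    ((cs.signedConj i * cs.signedConj j) ^ n) (t, ε) =
      ((cs.simple i * cs.simple j) ^ n * t * (cs.simple j * cs.simple i) ^ n,
        ε + ∑ k ∈ Finset.range (2 * n),
          if t = (cs.simple j * cs.simple i) ^ k * cs.simple j then 1 else 0) := by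
  set a := cs.simple i with ha
  set b := cs.simple j with hb
  have hbb : b * b = 1 := cs.simple_mul_simple_self j
  have hinv : (a * b)⁻¹ = b * a := by simp [ha, hb]
  have hflip : ∀ m : ℕ, (b * a) ^ m * b = b * (a * b) ^ m := fun m => by
    induction m with
    | zero => simp
    | succ m ih => rw [pow_succ', mul_assoc, ih, pow_succ']; simp only [mul_assoc]
  have hconj : ∀ z c : W, b * z * b = c ↔ z = b * c * b := fun z c => by
    rw [← eq_mul_inv_iff_mul_eq, ← eq_inv_mul_iff_mul_eq, inv_eq_of_mul_eq_one_left hbb, mul_assoc]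
  induction n with
  | zero => simp; rfl
  | succ n ih =>
    have hpow : (b * a) ^ n = ((a * b) ^ n)⁻¹ := by rw [← hinv, inv_pow]
    have h₁ : (a * b) ^ n * t * (b * a) ^ n = b ↔ t = (b * a) ^ (2 * n) * b := by
      rw [two_mul, pow_add, mul_assoc _ _ b, hflip, ← hinv, inv_pow, mul_inv_eq_iff_eq_mul,
        ← eq_inv_mul_iff_mul_eq]
    have h₂ : b * ((a * b) ^ n * t * (b * a) ^ n) * b = a ↔
        t = (b * a) ^ (2 * n + 1) * b := by
      have : (b * a) ^ (2 * n + 1) * b = ((a * b) ^ n)⁻¹ * (b * a * b * (a * b) ^ n) := by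
        rw [show 2 * n + 1 = n + (n + 1) by ring, pow_add, mul_assoc _ _ b, hflip, ← inv_pow, hinv,
          pow_succ']
        simp only [mul_assoc]
      rw [this, hconj, hpow, mul_inv_eq_iff_eq_mul, eq_inv_mul_iff_mul_eq]
    rw [pow_succ', functionEnd_mul_apply, ih, functionEnd_mul_apply]
    simp only [signedConj, ← ha, ← hb, h₁, h₂]
    rw [show 2 * (n + 1) = 2 * n + 1 + 1 by ring, Finset.sum_range_succ, Finset.sum_range_succ]
    refine Prod.ext ?_ ?_
    · simp only [pow_succ' (a * b), pow_succ (b * a), mul_assoc]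
    · simp only [add_assoc]

/-- With `n = M i j` the `2 * n` reflections in the sign sum are `n` reflections listed twice, so
they cancel mod 2. -/
theorem isLiftable_signedConj : M.IsLiftable cs.signedConj := by
  classical
  intro i j
  funext ⟨t, ε⟩
  rw [cs.signedConj_mul_pow_apply, two_mul, Finset.sum_range_add]
  simp only [pow_add, simple_mul_simple_pow, simple_mul_simple_pow', one_mul, mul_one,
    CharTwo.add_self_eq_zero, add_zero]
  rfl

/-- The action of `W` on `W × ZMod 2` extending `signedConj`. -/
noncomputable def signedConjHom : W →* Function.End (W × ZMod 2) :=
  cs.lift ⟨cs.signedConj, cs.isLiftable_signedConj⟩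

theorem signedConjHom_simple (i : B) : cs.signedConjHom (cs.simple i) = cs.signedConj i :=
  cs.lift_apply_simple _ i

-- The left side depends only on the element, so the parity of the multiplicity of `t` is the same
-- for all words of that element.
open Classical in
theorem signedConjHom_wordProd (ω : List B) (t : W) (ε : ZMod 2) :
    cs.signedConjHom (cs.wordProd ω) (t, ε) =
      (cs.wordProd ω * t * (cs.wordProd ω)⁻¹, ε + ((cs.rightInvSeq ω).count t : ZMod 2)) := by
  induction ω with
  | nil => simp; rfl
  | cons i ω ih =>
    rw [wordProd_cons, map_mul, functionEnd_mul_apply, ih,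
      signedConjHom_simple]
    have h : cs.wordProd ω * t * (cs.wordProd ω)⁻¹ = cs.simple i ↔
        (cs.wordProd ω)⁻¹ * cs.simple i * cs.wordProd ω = t := by
      rw [mul_inv_eq_iff_eq_mul, mul_assoc, inv_mul_eq_iff_eq_mul, eq_comm]
    refine Prod.ext ?_ ?_
    · simp [signedConj, mul_assoc]
    · simp only [signedConj, rightInvSeq, h, List.count_cons, beq_iff_eq]
      split_ifs <;> simp [add_assoc]

/-- A right descent of `w` occurs in the right inversion sequence of every word for `w`. -/
theorem simple_mem_rightInvSeq {ω : List B} {i : B}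
    (h : cs.IsRightDescent (cs.wordProd ω) i) : cs.simple i ∈ cs.rightInvSeq ω := by
  classical
  by_contra hmem
  obtain ⟨υ, hυ, hυω⟩ := cs.exists_isReduced (cs.wordProd ω * cs.simple i)
  -- The last letter `i` flips the sign and `ω` does not, so `cs.simple i` occurs an odd number of
  -- times for `υ`.
  have h₁ := cs.signedConjHom_wordProd υ (cs.simple i) 0
  rw [← hυω, map_mul, functionEnd_mul_apply, signedConjHom_simple,
    signedConj] at h₁
  have h₂ := congrArg Prod.snd h₁
  simp only [signedConjHom_wordProd, simple_mul_simple_cancel_right,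
    List.count_eq_zero.mpr hmem] at h₂
  by_cases hmem' : cs.simple i ∈ cs.rightInvSeq υ
  · have h₃ := (cs.isRightInversion_of_mem_rightInvSeq hυ hmem').2
    rw [← hυω, simple_mul_simple_cancel_right] at h₃
    exact lt_asymm h h₃
  · rw [List.count_eq_zero.mpr hmem'] at h₂
    simp at h₂

/-- The **exchange condition**. -/
theorem exists_exchange {ω : List B} {i : B} (h : cs.IsRightDescent (cs.wordProd ω) i) :
    ∃ (α : List B) (k : B) (β : List B), ω = α ++ k :: β ∧
      cs.wordProd ω * cs.simple i = cs.wordProd (α ++ β) := by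
  obtain ⟨n, hn, hni⟩ := List.mem_iff_getElem.mp (cs.simple_mem_rightInvSeq h)
  have hn' : n < ω.length := by simpa using hn
  refine ⟨ω.take n, ω[n], ω.drop (n + 1), by simp, ?_⟩
  rw [← hni, ← List.getD_eq_getElem _ 1 hn, wordProd_mul_getD_rightInvSeq,
    List.eraseIdx_eq_take_drop_succ]

/-! ### Involutions -/

/-- Conjugating an involution by one of its descents shortens it or fixes it. -/
theorem simple_conj_eq_or_length_lt {y : W} (hy : y⁻¹ = y) {i : B} (h : cs.IsRightDescent y i) :
    cs.simple i * y = y * cs.simple i ∨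
      cs.length (cs.simple i * y * cs.simple i) < cs.length y := by
  obtain ⟨α, hα, hαy⟩ := cs.exists_isReduced (cs.simple i * y)
  have hl : cs.IsLeftDescent y i := by rwa [← isRightDescent_inv_iff, hy]
  have hlen : α.length + 1 = cs.length y := by
    rw [← hα.eq, ← hαy]; exact cs.isLeftDescent_iff.mp hl
  have hyw : y = cs.wordProd (i :: α) := by
    rw [wordProd_cons, ← hαy, simple_mul_simple_cancel_left]
  -- Deleting the leading `i` gives commutation; deleting a later letter leaves a word still
  -- starting with `i`, which the conjugation strips.
  obtain ⟨γ, k, δ, he, hp⟩ := cs.exists_exchange (hyw ▸ h)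
  rw [← hyw] at hp
  cases γ with
  | nil =>
    obtain ⟨rfl, rfl⟩ : i = k ∧ α = δ := by simpa using he
    left
    rw [hp, hαy, List.nil_append]
  | cons j γ =>
    obtain ⟨rfl, rfl⟩ : i = j ∧ α = γ ++ k :: δ := by simpa using he
    right
    rw [mul_assoc, hp, List.cons_append, wordProd_cons, simple_mul_simple_cancel_left]
    refine (cs.length_wordProd_le _).trans_lt ?_
    simp at hlen ⊢
    omega

/-! ### Parabolic cosets -/

/-- Every product of a word in `J` is the product of a shortest such word. -/
theorem exists_shortest_word {J : Set B} (ω : List B) (hω : ∀ i ∈ ω, i ∈ J) :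
    ∃ υ : List B, (∀ i ∈ υ, i ∈ J) ∧ cs.wordProd υ = cs.wordProd ω ∧
      ∀ υ' : List B, (∀ i ∈ υ', i ∈ J) → cs.wordProd υ' = cs.wordProd υ →
        υ.length ≤ υ'.length := by
  obtain ⟨υ, ⟨h₁, h₂⟩, h₃⟩ := WellFounded.has_min
    (InvImage.wf (List.length : List B → ℕ) wellFounded_lt)
    {υ : List B | (∀ i ∈ υ, i ∈ J) ∧ cs.wordProd υ = cs.wordProd ω} ⟨ω, hω, rfl⟩
  exact ⟨υ, h₁, h₂, fun υ' h h' => not_lt.mp (h₃ υ' ⟨h, h'.trans h₂⟩)⟩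

/-- Lengths add when a shortest element of a parabolic left coset is multiplied by a shortest
word of the parabolic subgroup. -/
theorem length_mul_wordProd_of_shortest {J : Set B} {u : W}
    (hu : ∀ ω : List B, (∀ i ∈ ω, i ∈ J) → cs.length u ≤ cs.length (u * cs.wordProd ω))
    (ω : List B) (hω : ∀ i ∈ ω, i ∈ J)
    (hmin : ∀ υ : List B, (∀ i ∈ υ, i ∈ J) → cs.wordProd υ = cs.wordProd ω →
      ω.length ≤ υ.length) :
    cs.length (u * cs.wordProd ω) = cs.length u + ω.length := by
  induction ω using List.reverseRecOn with
  | nil => simp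
  | append_singleton ω i ih =>
    have hωJ : ∀ j ∈ ω, j ∈ J := fun j hj => hω j (by simp [hj])
    have hiJ : i ∈ J := hω i (by simp)
    have ih' := ih hωJ fun υ hυ he => by
      have := hmin (υ ++ [i]) (by
        intro j hj
        rcases List.mem_append.mp hj with hj | hj
        · exact hυ j hj
        · rwa [List.mem_singleton.mp hj]) (by simp [wordProd_append, he])
      simpa using this
    have hprod : u * cs.wordProd (ω ++ [i]) = u * cs.wordProd ω * cs.simple i := by
      simp [wordProd_append, mul_assoc]
    by_cases hd : cs.IsRightDescent (u * cs.wordProd ω) i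
    · exfalso
      obtain ⟨υ, hυ, rfl⟩ := cs.exists_isReduced u
      rw [← wordProd_append] at hd
      obtain ⟨α, k, β, he, hp⟩ := cs.exists_exchange hd
      -- A deletion inside `ω` contradicts `hmin`; one inside `υ` gives a shorter element of the
      -- coset of `u`.
      rcases List.append_eq_append_iff.mp he with ⟨γ, hα, hω'⟩ | ⟨γ, hυ', hβ⟩
      · subst hα hω'
        have := hmin (γ ++ β) (fun j hj => hωJ j (by
          rcases List.mem_append.mp hj with hj | hj <;> simp [hj])) (by
            rw [List.append_assoc, wordProd_append, cs.wordProd_append υ, mul_assoc] at hp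
            rw [cs.wordProd_append _ [i], wordProd_singleton]
            exact (mul_left_cancel hp).symm)
        simp at this
      · cases γ with
        | nil =>
          simp only [List.append_nil, List.nil_append] at hυ' hβ
          subst hυ' hβ
          have := hmin β (fun j hj => hωJ j (by simp [hj])) (by
            rw [wordProd_append, wordProd_append, mul_assoc] at hp
            rw [wordProd_append, wordProd_singleton]
            exact (mul_left_cancel hp).symm)
          simp at this
        | cons k' γ =>
          obtain ⟨rfl, rfl⟩ : k = k' ∧ β = γ ++ ω := by simpa using hβ
          subst hυ'
          have h₁ := hu (ω ++ [i] ++ ω.reverse) (by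
            intro j hj
            simp only [List.mem_append, List.mem_singleton, List.mem_reverse] at hj
            rcases hj with (hj | rfl) | hj
            exacts [hωJ j hj, hiJ, hωJ j hj])
          have h₂ : cs.wordProd (α ++ k :: γ) * cs.wordProd (ω ++ [i] ++ ω.reverse) =
              cs.wordProd (α ++ γ) := by
            rw [← List.append_assoc, wordProd_append, cs.wordProd_append (α ++ γ)] at hp
            rw [cs.wordProd_append (ω ++ [i]), cs.wordProd_append ω, wordProd_singleton,
              wordProd_reverse, ← mul_assoc, ← mul_assoc, hp, mul_inv_cancel_right]
          rw [h₂, hυ.eq] at h₁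
          have h₃ := h₁.trans (cs.length_wordProd_le _)
          simp at h₃
    · rw [hprod, cs.not_isRightDescent_iff.mp hd, ih']
      simp [add_assoc]

/-- An element without right descents in `J` is shortest in its left coset of the parabolic
subgroup of `J`. -/
theorem length_le_length_mul_wordProd {J : Set B} {x : W}
    (hx : ∀ i ∈ J, ¬ cs.IsRightDescent x i) (ω : List B) (hω : ∀ i ∈ ω, i ∈ J) :
    cs.length x ≤ cs.length (x * cs.wordProd ω) := by
  obtain ⟨α, hα, hmin⟩ := WellFounded.has_min
    (InvImage.wf (fun α : List B => cs.length (x * cs.wordProd α)) wellFounded_lt)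
    {α : List B | ∀ i ∈ α, i ∈ J} ⟨ω, hω⟩
  have hmin' : ∀ β : List B, (∀ i ∈ β, i ∈ J) →
      cs.length (x * cs.wordProd α) ≤ cs.length (x * cs.wordProd β) :=
    fun β hβ => not_lt.mp (hmin β hβ)
  suffices h : cs.wordProd α = 1 by simpa [h] using hmin' ω hω
  obtain ⟨υ, hυ, hυα, hυmin⟩ := cs.exists_shortest_word α.reverse (J := J) (by simpa using hα)
  rw [wordProd_reverse] at hυα
  have hlen := cs.length_mul_wordProd_of_shortest (J := J) (u := x * cs.wordProd α)
    (fun β hβ => by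
      rw [mul_assoc, ← wordProd_append]
      exact hmin' _ fun i hi => (List.mem_append.mp hi).elim (hα i) (hβ i)) υ hυ hυmin
  rw [hυα, mul_inv_cancel_right] at hlen
  -- `x` is the shortest coset element times `υ`, with additive lengths, so a last letter of `υ`
  -- would be a descent of `x` in `J`.
  rcases List.eq_nil_or_concat υ with rfl | ⟨υ, i, rfl⟩
  · simpa using hυα.symm
  · refine absurd ?_ (hx i (hυ i (by simp)))
    have : x * cs.simple i = x * cs.wordProd α * cs.wordProd υ := by
      rw [wordProd_concat, ← eq_mul_inv_iff_mul_eq, inv_simple] at hυα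
      rw [hυα]
      simp [mul_assoc]
    rw [IsRightDescent, this, hlen]
    have h₁ := cs.length_mul_le (x * cs.wordProd α) (cs.wordProd υ)
    have h₂ := cs.length_wordProd_le υ
    simp
    omega

theorem length_mul_wordProd {J : Set B} {x : W} (hx : ∀ i ∈ J, ¬ cs.IsRightDescent x i)
    (ω : List B) (hω : ∀ i ∈ ω, i ∈ J) :
    cs.length (x * cs.wordProd ω) = cs.length x + cs.length (cs.wordProd ω) := by
  obtain ⟨υ, hυ, hυω, hmin⟩ := cs.exists_shortest_word ω hω
  have h₁ := cs.length_mul_wordProd_of_shortest (cs.length_le_length_mul_wordProd hx) υ hυ hmin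
  have h₂ := cs.length_mul_wordProd_of_shortest (u := 1) (J := J) (by simp) υ hυ hmin
  rw [one_mul, length_one, zero_add] at h₂
  rw [← hυω, h₁, h₂]

/-- Every element is the product of an element without right descents in `J` and a word in `J`. -/
theorem exists_eq_mul_wordProd (J : Set B) (y : W) :
    ∃ (u : W) (ω : List B), (∀ i ∈ J, ¬ cs.IsRightDescent u i) ∧ (∀ i ∈ ω, i ∈ J) ∧
      y = u * cs.wordProd ω := by
  obtain ⟨α, hα, hmin⟩ := WellFounded.has_min
    (InvImage.wf (fun α : List B => cs.length (y * cs.wordProd α)) wellFounded_lt)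
    {α : List B | ∀ i ∈ α, i ∈ J} ⟨[], by simp⟩
  refine ⟨y * cs.wordProd α, α.reverse, fun i hi hd => ?_, by simpa using hα, by simp⟩
  refine hmin (α ++ [i]) ?_ ?_
  · intro j hj
    rcases List.mem_append.mp hj with hj | hj
    · exact hα j hj
    · rwa [List.mem_singleton.mp hj]
  · simpa [InvImage, wordProd_append, mul_assoc, IsRightDescent] using hd

/-- An involution commuting with all of its descents lies in the parabolic subgroup generated by
its descents. -/
theorem exists_word_of_commute_descents {y : W} (hy : y⁻¹ = y)
    (hc : ∀ i, cs.IsRightDescent y i → cs.simple i * y = y * cs.simple i) :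
    ∃ ω : List B, (∀ i ∈ ω, cs.IsRightDescent y i) ∧ y = cs.wordProd ω := by
  obtain ⟨u, ω, hu, hω, hyu⟩ := cs.exists_eq_mul_wordProd {i | cs.IsRightDescent y i} y
  suffices h : u = 1 by exact ⟨ω, hω, by simpa [h] using hyu⟩
  by_contra hne
  obtain ⟨i, hi⟩ := cs.exists_leftDescent_of_ne_one hne
  have hlen := cs.length_mul_wordProd hu ω hω
  have hdesc : cs.IsRightDescent y i := by
    rw [← hy, isRightDescent_inv_iff, IsLeftDescent, hyu, hlen, ← mul_assoc]
    exact (cs.length_mul_le _ _).trans_lt (Nat.add_lt_add_right hi _)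
  -- Hence `cs.simple i * u` stays in the coset where `u` is shortest, against `hi`.
  have hcomm : cs.simple i * u = u * cs.wordProd (ω ++ [i] ++ ω.reverse) := by
    have h := hc i hdesc
    rw [hyu, ← mul_assoc, ← eq_mul_inv_iff_mul_eq] at h
    rw [h]
    simp [wordProd_append, wordProd_cons, mul_assoc]
  have hle := cs.length_le_length_mul_wordProd hu (ω ++ [i] ++ ω.reverse) (by
    intro j hj
    simp only [List.mem_append, List.mem_singleton, List.mem_reverse] at hj
    rcases hj with (hj | rfl) | hj
    exacts [hω j hj, hdesc, hω j hj])
  rw [← hcomm] at hle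
  exact absurd hi (not_lt.mpr hle)

/-- Every product of two involutions is conjugate to such a product with additive lengths. -/
theorem exists_isConj_length_mul_eq {w : W} (hw : w ∈ stronglyRealElements W) :
    ∃ x y : W, x ^ 2 = 1 ∧ y ^ 2 = 1 ∧ IsConj w (x * y) ∧
      cs.length (x * y) = cs.length x + cs.length y := by
  obtain ⟨x₀, y₀, rfl, hx₀, hy₀⟩ := hw
  -- `ℓ(y)` comes first because a conjugation shortening `y` may lengthen `x`.
  obtain ⟨⟨x, y⟩, ⟨hx, hy, hconj⟩, hmin⟩ := WellFounded.has_min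
    (InvImage.wf (fun p : W × W => toLex (cs.length p.2, cs.length p.1)) wellFounded_lt)
    {p : W × W | p.1 ^ 2 = 1 ∧ p.2 ^ 2 = 1 ∧ IsConj (x₀ * y₀) (p.1 * p.2)}
    ⟨(x₀, y₀), hx₀, hy₀, IsConj.refl _⟩
  dsimp only at hx hy hconj
  have hmin' : ∀ x' y' : W, x' ^ 2 = 1 → y' ^ 2 = 1 → IsConj (x₀ * y₀) (x' * y') →
      ¬ (cs.length y' < cs.length y ∨
        cs.length y' = cs.length y ∧ cs.length x' < cs.length x) := by
    intro x' y' hx' hy' hc h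
    exact hmin (x', y') ⟨hx', hy', hc⟩ (Prod.Lex.toLex_lt_toLex.mpr h)
  have hxi : x⁻¹ = x := inv_eq_of_mul_eq_one_left (by rwa [← pow_two])
  have hyi : y⁻¹ = y := inv_eq_of_mul_eq_one_left (by rwa [← pow_two])
  have hsq : ∀ (i : B) (z : W), z ^ 2 = 1 → (cs.simple i * z * cs.simple i) ^ 2 = 1 := by
    intro i z hz
    rw [show cs.simple i * z * cs.simple i = MulAut.conj (cs.simple i) z by simp, ← map_pow, hz,
      map_one]
  have hconj' : ∀ i : B, IsConj (x₀ * y₀)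
      (cs.simple i * x * cs.simple i * (cs.simple i * y * cs.simple i)) := fun i =>
    hconj.trans (isConj_iff.mpr ⟨cs.simple i, by simp [mul_assoc]⟩)
  have hcomm : ∀ i, cs.IsRightDescent y i → cs.simple i * y = y * cs.simple i := fun i hi =>
    (cs.simple_conj_eq_or_length_lt hyi hi).resolve_right fun h =>
      hmin' _ _ (hsq i x hx) (hsq i y hy) (hconj' i) (Or.inl h)
  have hdisj : ∀ i ∈ {i | cs.IsRightDescent y i}, ¬ cs.IsRightDescent x i := by
    intro i hi hxd
    have hyc := hcomm i hi
    rcases cs.simple_conj_eq_or_length_lt hxi hxd with h | h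
    · refine hmin' (x * cs.simple i) (cs.simple i * y) ?_ ?_ (by simpa [mul_assoc] using hconj) ?_
      · rw [(show Commute x (cs.simple i) from h.symm).mul_pow, hx, simple_sq, one_mul]
      · rw [(show Commute (cs.simple i) y from hyc).mul_pow, hy, simple_sq, one_mul]
      · left
        rw [hyc]
        exact hi
    · exact hmin' _ _ (hsq i x hx) (hsq i y hy) (hconj' i)
        (Or.inr ⟨by rw [hyc, simple_mul_simple_cancel_right], h⟩)
  obtain ⟨ω, hω, hyω⟩ := cs.exists_word_of_commute_descents hyi hcomm
  refine ⟨x, y, hx, hy, hconj, ?_⟩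
  have h := cs.length_mul_wordProd hdisj ω hω
  rwa [← hyω] at h

end CoxeterSystem

theorem theorem1p1 {B W : Type*} [Group W] {M : CoxeterMatrix B} (cs : CoxeterSystem M W)
    (w : W) (hw : w ∈ stronglyRealElements W) :
    ∃ w' : W, IsConj w w' ∧ w' ∈ stronglyRealElements W ∧ cs.excess w' = 0 ∧
      ∃ σ τ : W, σ ^ 2 = 1 ∧ τ ^ 2 = 1 ∧ w' = σ * τ ∧
        cs.length w' = cs.length σ + cs.length τ := by
  obtain ⟨x, y, hx, hy, hconj, hlen⟩ := cs.exists_isConj_length_mul_eq hw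
  have hmem : x * y ∈ stronglyRealElements W := ⟨x, y, rfl, hx, hy⟩
  refine ⟨x * y, hconj, hmem, ?_, x, y, hx, hy, rfl, hlen⟩
  refine (cs.isLeast_excess hmem).unique ⟨⟨x, y, rfl, hx, hy, ?_⟩, ?_⟩
  · rw [hlen]
    push_cast
    ring
  · rintro n ⟨a, b, hab, -, -, rfl⟩
    have := cs.length_mul_le a b
    rw [hab]
    omega
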